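/- Let $\mathbb F_q$ be a finite field of characteristic $2$ with $q$ elements, let $\nu\ge 0$ be an integer and $n=2\nu+1$. Let $$H=\begin{pmatrix}0&I^{(\nu)}\\ I^{(\nu)}&0\end{pmatrix},\qquad S=S_{2\nu+1}=\begin{pmatrix}0&I^{(\nu)}&0\\ I^{(\nu)}&0&0\\ 0&0&1\end{pmatrix},$$ where $I^{(\nu)}$ is the $\nu\times\nu$ identity matrix, and let $$Ps_n(\mathbb F_q,S)=\{\,T\in \mathrm{GL}_n(\mathbb F_q): T S\,{}^tT=S\,\}$$ be the pseudo-symplectic group. Each $T\in\mathrm{GL}_n(\mathbb F_q)$ acts on the rational function field $\mathbb F_q(X_1,\dots,X_n)$ by the $\mathbb F_q$-automorphism $\sigma_T$ with $(\sigma_T(X_1),\dots,\sigma_T(X_n))=(X_1,\dots,X_n)T$; for a subgroup $G$ of $\mathrm{GL}_n(\mathbb F_q)$ put $$\mathbb F_q(X_1,\dots,X_n)^{G}=\{\,f\in\mathbb F_q(X_1,\dots,X_n):\sigma_T(f)=f\text{ for all }T\in G\,\}.$$ For $k\ge 1$ let $$P_{n-1,k}=(X_1,\dots,X_{n-1})\,H\,{}^t\bigl(X_1^{q^k},\dots,X_{n-1}^{q^k}\bigr).$$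 Then $$\mathbb F_q(X_1,\dots,X_n)^{Ps_n(\mathbb F_q,S)}=\mathbb F_q(P_{n-1,1},\dots,P_{n-1,n-1},X_n).$$ -/

import Mathlib

open scoped Matrix

noncomputable section

namespace PseudoSymplectic

/-- The rational function field `K(X_i : i ∈ ι)`. -/
abbrev RatField (ι K : Type*) [Field K] : Type _ := FractionRing (MvPolynomial ι K)

/-- The indeterminate `X_i` as an element of the rational function field. -/
def ratX {ι : Type*} (K : Type*) [Field K] (i : ι) : RatField ι K :=
  algebraMap (MvPolynomial ι K) (RatField ι K) (MvPolynomial.X i)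

section Action

variable {ι K : Type*} [Fintype ι] [Field K]

/-- The linear substitution `(X_1, …, X_n) ↦ (X_1, …, X_n) T` on polynomials. -/
def polySubst (T : Matrix ι ι K) : MvPolynomial ι K →ₐ[K] MvPolynomial ι K :=
  MvPolynomial.aeval ((MvPolynomial.X : ι → MvPolynomial ι K) ᵥ* T.map MvPolynomial.C)

theorem polySubst_X (T : Matrix ι ι K) (i : ι) :
    polySubst T (MvPolynomial.X i) = ∑ j, MvPolynomial.X j * MvPolynomial.C (T j i) := by
  simp [polySubst, Matrix.vecMul, dotProduct]

theorem polySubst_mul (T U : Matrix ι ι K) :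
    polySubst (T * U) = (polySubst T).comp (polySubst U) := by
  apply MvPolynomial.algHom_ext
  intro i
  have hC : ∀ a : K, polySubst T (MvPolynomial.C a) = MvPolynomial.C a := fun a =>
    (polySubst T).commutes a
  simp only [AlgHom.comp_apply, polySubst_X, map_sum, map_mul, hC, Matrix.mul_apply,
    Finset.mul_sum, Finset.sum_mul]
  rw [Finset.sum_comm]
  simp only [mul_assoc]

variable [DecidableEq ι]

theorem polySubst_one : polySubst (1 : Matrix ι ι K) = AlgHom.id K _ := by
  apply MvPolynomial.algHom_ext
  intro i
  simp [polySubst_X, Matrix.one_apply]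

/-- The linear substitution by an invertible matrix as an automorphism of `K[X_1, …, X_n]`. -/
def polyAut (T : GL ι K) : MvPolynomial ι K ≃ₐ[K] MvPolynomial ι K :=
  AlgEquiv.ofAlgHom (polySubst (T : Matrix ι ι K)) (polySubst ((T⁻¹ : GL ι K) : Matrix ι ι K))
    (by rw [← polySubst_mul, ← Units.val_mul, mul_inv_cancel, Units.val_one, polySubst_one])
    (by rw [← polySubst_mul, ← Units.val_mul, inv_mul_cancel, Units.val_one, polySubst_one])

/-- The automorphism `σ_T` of `K(X_1, …, X_n)` over `K` with
`(σ_T X_1, …, σ_T X_n) = (X_1, …, X_n) T`, that is, `σ_T f = f((X_1, …, X_n) T)`. -/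
def sigma (T : GL ι K) : RatField ι K ≃ₐ[K] RatField ι K :=
  IsFractionRing.algEquivOfAlgEquiv (polyAut T)

theorem sigma_algebraMap (T : GL ι K) (p : MvPolynomial ι K) :
    sigma T (algebraMap (MvPolynomial ι K) (RatField ι K) p) =
      algebraMap (MvPolynomial ι K) (RatField ι K) (polySubst (T : Matrix ι ι K) p) :=
  IsFractionRing.algEquivOfAlgEquiv_algebraMap (polyAut T) p

theorem sigma_ratX (T : GL ι K) (i : ι) :
    sigma T (ratX K i) = ∑ j, ratX K j * algebraMap K (RatField ι K) (T j i) := by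
  rw [ratX, sigma_algebraMap, polySubst_X, map_sum]
  refine Finset.sum_congr rfl fun j _ => ?_
  rw [map_mul, IsScalarTower.algebraMap_apply K (MvPolynomial ι K) (RatField ι K)]
  rfl

/-- The invariant field `K(X_1, …, X_n)^G = {f | σ_T f = f for all T ∈ G}` of a group `G` of
invertible matrices, as an intermediate field of `K(X_1, …, X_n)` over `K`. -/
def invariantField (G : Subgroup (GL ι K)) : IntermediateField K (RatField ι K) where
  carrier := {f | ∀ T ∈ G, sigma T f = f}
  mul_mem' hf hg T hT := by rw [map_mul, hf T hT, hg T hT]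
  add_mem' hf hg T hT := by rw [map_add, hf T hT, hg T hT]
  algebraMap_mem' a T _ := (sigma T).commutes a
  inv_mem' f hf T hT := by rw [map_inv₀, hf T hT]

/-- The group `{T ∈ GL_n(K) | T S ᵗT = S}` attached to a square matrix `S`. It is the
pseudo-symplectic group `Ps_n(K, S)` when `K` has characteristic two and `S` is a nonsingular
symmetric matrix that is not alternate. -/
def congruenceGroup (S : Matrix ι ι K) : Subgroup (GL ι K) where
  carrier := {T | (T : Matrix ι ι K) * S * (T : Matrix ι ι K)ᵀ = S}
  one_mem' := by simp
  mul_mem' {T U} hT hU := by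
    change (T : Matrix ι ι K) * S * (T : Matrix ι ι K)ᵀ = S at hT
    change (U : Matrix ι ι K) * S * (U : Matrix ι ι K)ᵀ = S at hU
    change ((T * U : GL ι K) : Matrix ι ι K) * S * ((T * U : GL ι K) : Matrix ι ι K)ᵀ = S
    calc ((T * U : GL ι K) : Matrix ι ι K) * S * ((T * U : GL ι K) : Matrix ι ι K)ᵀ
        = (T : Matrix ι ι K) * ((U : Matrix ι ι K) * S * (U : Matrix ι ι K)ᵀ) *
            (T : Matrix ι ι K)ᵀ := by
          rw [Units.val_mul, Matrix.transpose_mul]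
          simp only [Matrix.mul_assoc]
      _ = S := by rw [hU, hT]
  inv_mem' {T} hT := by
    change (T : Matrix ι ι K) * S * (T : Matrix ι ι K)ᵀ = S at hT
    change ((T⁻¹ : GL ι K) : Matrix ι ι K) * S * ((T⁻¹ : GL ι K) : Matrix ι ι K)ᵀ = S
    have h1 : ((T⁻¹ : GL ι K) : Matrix ι ι K) * (T : Matrix ι ι K) = 1 := by
      rw [← Units.val_mul, inv_mul_cancel, Units.val_one]
    have h2 : (T : Matrix ι ι K)ᵀ * ((T⁻¹ : GL ι K) : Matrix ι ι K)ᵀ = 1 := by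
      rw [← Matrix.transpose_mul, h1, Matrix.transpose_one]
    calc ((T⁻¹ : GL ι K) : Matrix ι ι K) * S * ((T⁻¹ : GL ι K) : Matrix ι ι K)ᵀ
        = ((T⁻¹ : GL ι K) : Matrix ι ι K) *
            ((T : Matrix ι ι K) * S * (T : Matrix ι ι K)ᵀ) *
            ((T⁻¹ : GL ι K) : Matrix ι ι K)ᵀ := by rw [hT]
      _ = (((T⁻¹ : GL ι K) : Matrix ι ι K) * (T : Matrix ι ι K)) * S *
            ((T : Matrix ι ι K)ᵀ * ((T⁻¹ : GL ι K) : Matrix ι ι K)ᵀ) := by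
          simp only [Matrix.mul_assoc]
      _ = S := by rw [h1, h2, Matrix.one_mul, Matrix.mul_one]

end Action

/-- The `n - 1 = 2ν` indices of the first block: `X_1, …, X_ν`, then `X_{ν+1}, …, X_{2ν}`. -/
abbrev IndexH (ν : ℕ) : Type := Fin ν ⊕ Fin ν

/-- The `n = 2ν + 1` indices: those of the first block, then the last index `n`. -/
abbrev IndexS (ν : ℕ) : Type := IndexH ν ⊕ Fin 1

/-- The last index `n = 2ν + 1`. -/
abbrev lastIndex (ν : ℕ) : IndexS ν := Sum.inr 0

/-- The `2ν × 2ν` hyperbolic matrix `[[0, I], [I, 0]]`. -/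
def matH (ν : ℕ) (K : Type*) [Field K] : Matrix (IndexH ν) (IndexH ν) K :=
  Matrix.fromBlocks 0 1 1 0

/-- The `(2ν+1) × (2ν+1)` matrix `S_{2ν+1} = [[0, I, 0], [I, 0, 0], [0, 0, 1]]`. -/
def matS (ν : ℕ) (K : Type*) [Field K] : Matrix (IndexS ν) (IndexS ν) K :=
  Matrix.fromBlocks (matH ν K) 0 0 1

/-- The pseudo-symplectic group `Ps_{2ν+1}(K, S_{2ν+1}) = {T ∈ GL_{2ν+1}(K) | T S ᵗT = S}`. -/
def Ps (ν : ℕ) (K : Type*) [Field K] : Subgroup (GL (IndexS ν) K) :=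
  congruenceGroup (matS ν K)

/-- `P_{n-1,k} = (X_1, …, X_{n-1}) H ᵗ(X_1^{q^k}, …, X_{n-1}^{q^k})` in `F_q(X_1, …, X_n)`, where
`n = 2ν + 1` and `q` is the number of elements of the finite field `F`. -/
def polyP (ν : ℕ) (F : Type*) [Field F] [Fintype F] (k : ℕ) : RatField (IndexS ν) F :=
  (fun i : IndexH ν => ratX F (Sum.inl i : IndexS ν)) ⬝ᵥ
    ((matH ν F).map (algebraMap F (RatField (IndexS ν) F)) *ᵥ
      fun i : IndexH ν => ratX F (Sum.inl i : IndexS ν) ^ (Fintype.card F) ^ k)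

end PseudoSymplectic

end

/-!
Let `q` be the number of elements of `F` and `m = 2ν`. Comparing diagonals in `T S ᵗT = S` shows
that in characteristic two the pseudo-symplectic matrices are exactly the `diag(A, 1)` with `A`
symplectic (`exists_fromBlocks_of_mem_Ps`, `exists_mem_Ps`). They fix `X_n`, and as `A` has entries
in `F` it commutes with `q`-th powers, so they fix the polynomials `P_k = x H ᵗ(x ^ q ^ k)`, where
`x = (X_1, …, X_m)`.

Conversely, let `K` be the field generated by `P_1, …, P_m` and `X_n`. The pairings
`x ^ q ^ a H ᵗ(x ^ q ^ b)` with `a, b ≤ m` are powers of the `P_k` or zero, and the first `m`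
vectors `x ^ q ^ a` form an invertible matrix, the Moore matrix of `x` (`isUnit_det_moore`).

* Expressing `x ^ q ^ m` through these vectors by means of the pairings gives a monic `q`-polynomial
  over `K` of degree `q ^ m` with roots `X_1, …, X_m` (`exists_qPolynomial`). Its roots are the
  `q ^ m` distinct `F`-linear combinations of the `X_i`, so `F(X_1, …, X_n)` is the splitting field
  of a separable polynomial over `K`, hence Galois over `K` (`isGalois_of_hyp_mem`).
* If `y` is the image of `x` under an automorphism over `K`, then all the pairings of `x` and `y`
  agree, so a single isometry `B` sends each `x ^ q ^ a` with `a ≤ m` to `y ^ q ^ a`. The matrix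
  `B ^ (q)` of `q`-th powers does the same for `1 ≤ a ≤ m`, whence `B ^ (q) = B` and `B` has entries
  in `F` (`exists_symplectic_of_hyp_eq`). The automorphism therefore is `σ_T` with
  `T = diag(B, 1)` pseudo-symplectic.

An invariant of the pseudo-symplectic group is thus fixed by the Galois group of
`F(X_1, …, X_n)` over `K`, and lies in `K`.
-/

noncomputable section

namespace PseudoSymplectic

/-! ### Moore matrices and `q`-polynomials -/

theorem injective_linearCombination {F L ι : Type*} [Field F] [Field L] [Algebra F L] [Fintype ι]
    {x : ι → L} (hx : LinearIndependent F x) :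
    Function.Injective fun v : ι → F => ∑ i, v i • x i := by
  intro v w h
  have h' := Fintype.linearIndependent_iff.1 hx (v - w)
    (by simpa [sub_smul, sub_eq_zero] using h)
  funext i
  simpa [sub_eq_zero] using h' i

/-- The Moore matrix `(x_i ^ q ^ (e a))`, with rows `a` and columns `i`, where `q` is the number
of elements of `F`. -/
def moore {ι : Type*} (F : Type*) {L : Type*} [Fintype F] [Field L] (e : ι → ℕ) (x : ι → L) :
    Matrix ι ι L :=
  Matrix.of fun a i => x i ^ Fintype.card F ^ e a

theorem moore_row {ι F L : Type*} [Fintype F] [Field L] (e : ι → ℕ) (x : ι → L) (a : ι) :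
    moore F e x a = fun i => x i ^ Fintype.card F ^ e a :=
  rfl

section FrobeniusPowers

open Polynomial

variable (F : Type*) {L : Type*} [Field F] [Fintype F] [Field L] [Algebra F L]

/-- The `k`-th iterate `x ↦ x ^ q ^ k` of the Frobenius map, `q` being the number of elements
of `F`, as an endomorphism of the `F`-algebra `L`. -/
def frobPow (L : Type*) [Field L] [Algebra F L] (k : ℕ) : L →ₐ[F] L :=
  FiniteField.frobeniusAlgHom F L ^ k

theorem frobPow_apply (k : ℕ) (x : L) : frobPow F L k x = x ^ Fintype.card F ^ k := by
  rw [frobPow, AlgHom.coe_pow, FiniteField.coe_frobeniusAlgHom, pow_iterate]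

theorem mem_range_algebraMap_of_pow_card_eq {x : L} (hx : x ^ Fintype.card F = x) :
    ∃ a : F, algebraMap F L a = x := by
  classical
  have hq := Fintype.one_lt_card (α := F)
  have hp : (X ^ Fintype.card F - X : L[X]) ≠ 0 := FiniteField.X_pow_card_sub_X_ne_zero L hq
  have hr := roots_eq_of_natDegree_le_card_of_ne_zero
    (S := Finset.univ.image (algebraMap F L)) (p := X ^ Fintype.card F - X)
    (by
      intro y hy
      obtain ⟨a, -, rfl⟩ := Finset.mem_image.1 hy
      simp [← map_pow, FiniteField.pow_card])
    (by
      rw [FiniteField.X_pow_card_sub_X_natDegree_eq L hq,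
        Finset.card_image_of_injective _ (algebraMap F L).injective, Finset.card_univ])
    hp
  have hx' : x ∈ (X ^ Fintype.card F - X : L[X]).roots := by
    rw [mem_roots hp]; simp [hx]
  rw [hr] at hx'
  simpa using hx'

variable {ι : Type*} [Fintype ι]

/-- A `q`-polynomial acts `F`-linearly, so its values on `F`-linear combinations of the `x i`
are determined by its values at the `x i`. -/
theorem sum_mul_pow_linearCombination {κ : Type*} [Fintype κ] (c : κ → L) (e : κ → ℕ)
    (x : ι → L) (v : ι → F) :
    ∑ a, c a * (∑ i, v i • x i) ^ Fintype.card F ^ e a =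
      ∑ i, v i • ∑ a, c a * x i ^ Fintype.card F ^ e a := by
  simp only [← frobPow_apply, map_sum, map_smul, Finset.mul_sum, Finset.smul_sum]
  rw [Finset.sum_comm]
  simp only [mul_smul_comm]

variable {F}

/-- The Moore matrix of linearly independent elements is invertible: a linear relation between
its rows is a `q`-polynomial of degree less than `q ^ m` with `q ^ m` roots. -/
theorem isUnit_det_moore [DecidableEq ι] {m : ℕ} (e : ι ≃ Fin m) {x : ι → L}
    (hx : LinearIndependent F x) : IsUnit (moore F (fun a => (e a : ℕ)) x).det := by
  classical
  rw [isUnit_iff_ne_zero]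
  intro hdet
  obtain ⟨c, hc, hcM⟩ := Matrix.exists_vecMul_eq_zero_iff.2 hdet
  have hrel : ∀ i, ∑ a, c a * x i ^ Fintype.card F ^ (e a : ℕ) = 0 := fun i => congrFun hcM i
  have hq := Fintype.one_lt_card (α := F)
  set p : L[X] := ∑ a, C (c a) * X ^ Fintype.card F ^ (e a : ℕ) with hp
  have hcoeff : ∀ b, p.coeff (Fintype.card F ^ (e b : ℕ)) = c b := by
    intro b
    rw [hp, finsetSum_coeff, Finset.sum_eq_single b]
    · simp
    · intro a _ hab
      rw [coeff_C_mul, coeff_X_pow, if_neg, mul_zero]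
      intro h
      exact hab (e.injective (Fin.ext (Nat.pow_right_injective hq h.symm)))
    · simp
  -- The exponents `q ^ e a` are distinct, so a nonzero relation is a nonzero polynomial.
  obtain ⟨b, hb⟩ := Function.ne_iff.1 hc
  have hp0 : p ≠ 0 := fun h => hb (by rw [← hcoeff b, h]; simp)
  have hdeg : p.degree < (Fintype.card F ^ m : ℕ) := by
    refine (degree_sum_le _ _).trans_lt ((Finset.sup_lt_iff (WithBot.bot_lt_coe _)).2 ?_)
    intro a _
    refine (degree_C_mul_X_pow_le _ _).trans_lt ?_
    exact_mod_cast Nat.pow_lt_pow_right hq (e a).isLt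
  have hroots : p.roots.toFinset.card ≤ p.natDegree :=
    (Multiset.toFinset_card_le _).trans (card_roots' p)
  have hsub : Finset.univ.image (fun v : ι → F => ∑ i, v i • x i) ⊆ p.roots.toFinset := by
    intro y hy
    obtain ⟨v, -, rfl⟩ := Finset.mem_image.1 hy
    rw [Multiset.mem_toFinset, mem_roots hp0, IsRoot.def, hp, eval_finsetSum]
    simpa [hrel] using sum_mul_pow_linearCombination F c (fun a => (e a : ℕ)) x v
  have hcard := Finset.card_le_card hsub
  rw [Finset.card_image_of_injective _ (injective_linearCombination hx), Finset.card_univ,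
    Fintype.card_fun, Fintype.card_congr e, Fintype.card_fin] at hcard
  have := (natDegree_lt_iff_degree_lt hp0).2 hdeg
  omega

/-- If linearly independent elements `x i` of `L` are roots of a monic `q`-polynomial of degree
`q ^ m` over a subfield `K`, where `m` is the number of the `x i`, then the `F`-span of the `x i`
is the full set of its `q ^ m` roots; it is therefore separable and splits in `L`. -/
theorem separable_and_splits_of_qPolynomial {K : Type*} [Field K] [Algebra K L]
    {m : ℕ} (e : ι ≃ Fin m) {x : ι → L} (hx : LinearIndependent F x) (c : ι → K)
    (hc : ∀ i, x i ^ Fintype.card F ^ m =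
      ∑ a, algebraMap K L (c a) * x i ^ Fintype.card F ^ (e a : ℕ)) :
    ∃ p : K[X], p.Separable ∧ (p.map (algebraMap K L)).Splits ∧ ∀ i, x i ∈ p.rootSet L := by
  classical
  have hq := Fintype.one_lt_card (α := F)
  set r : K[X] := ∑ a, C (c a) * X ^ Fintype.card F ^ (e a : ℕ) with hr
  set p : K[X] := X ^ Fintype.card F ^ m - r with hp
  have hdeg : r.degree < (Fintype.card F ^ m : ℕ) := by
    refine (degree_sum_le _ _).trans_lt ((Finset.sup_lt_iff (WithBot.bot_lt_coe _)).2 ?_)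
    intro a _
    refine (degree_C_mul_X_pow_le _ _).trans_lt ?_
    exact_mod_cast Nat.pow_lt_pow_right hq (e a).isLt
  have hmonic : p.Monic := (monic_X_pow _).sub_of_left (by rwa [degree_X_pow])
  have hnat : p.natDegree = Fintype.card F ^ m := by
    have : p.degree = (Fintype.card F ^ m : ℕ) := by
      rw [hp, degree_sub_eq_left_of_degree_lt (by rwa [degree_X_pow]), degree_X_pow]
    exact natDegree_eq_of_degree_eq_some this
  have hmap0 : p.map (algebraMap K L) ≠ 0 := (hmonic.map _).ne_zero
  have heval : ∀ y : L, (p.map (algebraMap K L)).eval y =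
      y ^ Fintype.card F ^ m -
        ∑ a, algebraMap K L (c a) * y ^ Fintype.card F ^ (e a : ℕ) := by
    intro y
    simp [hp, hr, Polynomial.map_sum, eval_finsetSum]
  have hroots := roots_eq_of_natDegree_le_card_of_ne_zero
    (S := Finset.univ.image (fun v : ι → F => ∑ i, v i • x i)) (p := p.map (algebraMap K L))
    (by
      intro y hy
      obtain ⟨v, -, rfl⟩ := Finset.mem_image.1 hy
      rw [heval, sum_mul_pow_linearCombination, sub_eq_zero, ← frobPow_apply, map_sum]
      simp only [map_smul, frobPow_apply, hc])
    (by
      rw [Finset.card_image_of_injective _ (injective_linearCombination hx), Finset.card_univ,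
        Fintype.card_fun, Fintype.card_congr e, Fintype.card_fin, natDegree_map, hnat])
    hmap0
  have hsplits : (p.map (algebraMap K L)).Splits := by
    rw [splits_iff_card_roots, hroots, natDegree_map, hnat]
    rw [Finset.card_val, Finset.card_image_of_injective _ (injective_linearCombination hx),
      Finset.card_univ, Fintype.card_fun, Fintype.card_congr e, Fintype.card_fin]
  refine ⟨p, (nodup_aroots_iff_of_splits hmonic.ne_zero hsplits).1 ?_, hsplits, fun i => ?_⟩
  · rw [aroots_def, hroots]
    exact Finset.nodup _
  · rw [mem_rootSet, aeval_def, ← eval_map, heval, hc, sub_self]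
    exact ⟨hmonic.ne_zero, rfl⟩

end FrobeniusPowers

/-! ### The hyperbolic form and Frobenius powers -/

section Hyperbolic

/-- The bilinear form `x H ᵗy` of the hyperbolic matrix `H`. -/
def hyp {ν : ℕ} {L : Type*} [Field L] (x y : IndexH ν → L) : L :=
  x ⬝ᵥ (matH ν L *ᵥ y)

variable {ν : ℕ} {L : Type*} [Field L]

theorem hyp_apply (x y : IndexH ν → L) :
    hyp x y = ∑ a, (x (Sum.inl a) * y (Sum.inr a) + x (Sum.inr a) * y (Sum.inl a)) := by
  simp [hyp, matH, dotProduct, Matrix.fromBlocks_mulVec, Finset.sum_add_distrib]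

theorem hyp_comm (x y : IndexH ν → L) : hyp x y = hyp y x := by
  simp only [hyp_apply]
  exact Finset.sum_congr rfl fun a _ => by ring

theorem hyp_self [CharP L 2] (x : IndexH ν → L) : hyp x x = 0 := by
  rw [hyp_apply]
  exact Finset.sum_eq_zero fun a _ => by rw [mul_comm, CharTwo.add_self_eq_zero]

theorem map_hyp {L' G : Type*} [Field L'] [FunLike G L L'] [RingHomClass G L L'] (f : G)
    (x y : IndexH ν → L) :
    f (hyp x y) = hyp (fun i => f (x i)) (fun i => f (y i)) := by
  simp [hyp_apply]

theorem matH_map {L' : Type*} [Field L'] (f : L →+* L') : (matH ν L).map f = matH ν L' := by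
  simp [matH, Matrix.fromBlocks_map]

theorem matH_mul_self : matH ν L * matH ν L = 1 := by
  simp [matH, Matrix.fromBlocks_multiply]

theorem isUnit_matH : IsUnit (matH ν L) :=
  ⟨⟨_, _, matH_mul_self, matH_mul_self⟩, rfl⟩

theorem gram_apply {κ : Type*} (M : Matrix κ (IndexH ν) L) (a b : κ) :
    (M * matH ν L * Mᵀ) a b = hyp (M a) (M b) := by
  rw [hyp, Matrix.dotProduct_mulVec]
  rfl

theorem hyp_vecMul {B : Matrix (IndexH ν) (IndexH ν) L} (hB : B * matH ν L * Bᵀ = matH ν L)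
    (x y : IndexH ν → L) : hyp (x ᵥ* B) (y ᵥ* B) = hyp x y := by
  have : hyp (x ᵥ* B) (y ᵥ* B) = x ⬝ᵥ ((B * matH ν L * Bᵀ) *ᵥ y) := by
    rw [hyp, ← Matrix.mulVec_transpose B y, ← Matrix.dotProduct_mulVec, Matrix.mulVec_mulVec,
      Matrix.mulVec_mulVec, Matrix.mul_assoc]
  rw [this, hB, hyp]

theorem isUnit_of_mul_mul_transpose {ι : Type*} [Fintype ι] [DecidableEq ι]
    {S B : Matrix ι ι L} (hS : IsUnit S) (hB : B * S * Bᵀ = S) : IsUnit B := by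
  rw [Matrix.isUnit_iff_isUnit_det] at hS ⊢
  rw [← hB, Matrix.det_mul, Matrix.det_mul] at hS
  exact isUnit_of_mul_isUnit_left (isUnit_of_mul_isUnit_left hS)

variable (F : Type*) [Field F] [Fintype F] [Algebra F L]

theorem hyp_pow_pow_add (x : IndexH ν → L) (a k : ℕ) :
    hyp (fun i => x i ^ Fintype.card F ^ a) (fun i => x i ^ Fintype.card F ^ (a + k)) =
      hyp x (fun i => x i ^ Fintype.card F ^ k) ^ Fintype.card F ^ a := by
  rw [← frobPow_apply F a (hyp _ _)]
  have := map_hyp (frobPow F L a) x (fun i => x i ^ Fintype.card F ^ k)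
  simp only [frobPow_apply] at this ⊢
  rw [this]
  simp only [← pow_mul, ← pow_add, add_comm k a]

/-- If every `q ^ k`-power pairing `x H ᵗ(x ^ q ^ k)` with `1 ≤ k ≤ m` lies in the subring `R`,
then so does the pairing of any two of the Frobenius powers `x, x ^ q, …, x ^ q ^ m`. -/
theorem hyp_pow_pow_mem [CharP L 2] {m : ℕ} {R : Subring L} {x : IndexH ν → L}
    (h : ∀ k ∈ Set.Icc 1 m, hyp x (fun i => x i ^ Fintype.card F ^ k) ∈ R) {a b : ℕ}
    (ha : a ≤ m) (hb : b ≤ m) :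
    hyp (fun i => x i ^ Fintype.card F ^ a) (fun i => x i ^ Fintype.card F ^ b) ∈ R := by
  wlog hab : a ≤ b generalizing a b
  · rw [hyp_comm]
    exact this hb ha (le_of_not_ge hab)
  obtain ⟨k, rfl⟩ := Nat.exists_eq_add_of_le hab
  rcases Nat.eq_zero_or_pos k with rfl | hk
  · rw [add_zero, hyp_self]
    exact R.zero_mem
  · rw [hyp_pow_pow_add]
    exact R.pow_mem (h k ⟨hk, by omega⟩) _

theorem hyp_pow_pow_congr [CharP L 2] {m : ℕ} {x y : IndexH ν → L}
    (h : ∀ k ∈ Set.Icc 1 m, hyp x (fun i => x i ^ Fintype.card F ^ k) =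
      hyp y (fun i => y i ^ Fintype.card F ^ k)) {a b : ℕ} (ha : a ≤ m) (hb : b ≤ m) :
    hyp (fun i => x i ^ Fintype.card F ^ a) (fun i => x i ^ Fintype.card F ^ b) =
      hyp (fun i => y i ^ Fintype.card F ^ a) (fun i => y i ^ Fintype.card F ^ b) := by
  wlog hab : a ≤ b generalizing a b
  · rw [hyp_comm, this hb ha (le_of_not_ge hab), hyp_comm]
  obtain ⟨k, rfl⟩ := Nat.exists_eq_add_of_le hab
  rcases Nat.eq_zero_or_pos k with rfl | hk
  · rw [add_zero, hyp_self, hyp_self]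
  · rw [hyp_pow_pow_add, hyp_pow_pow_add, h k ⟨hk, by omega⟩]

/-- A numbering of the `2ν` indices of the first block. -/
def indexEquiv (ν : ℕ) : IndexH ν ≃ Fin (2 * ν) :=
  finSumFinEquiv.trans (finCongr (two_mul ν).symm)

variable {F}

/-- Two vectors `x`, `y` with the same values `x H ᵗ(x ^ q ^ k)` for `1 ≤ k ≤ 2ν`, the first
with `F`-linearly independent entries, differ by a symplectic matrix with entries in `F`. -/
theorem exists_symplectic_of_hyp_eq [CharP L 2] {x y : IndexH ν → L}
    (hx : LinearIndependent F x)
    (h : ∀ k ∈ Set.Icc 1 (2 * ν), hyp x (fun i => x i ^ Fintype.card F ^ k) =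
      hyp y (fun i => y i ^ Fintype.card F ^ k)) :
    ∃ B : Matrix (IndexH ν) (IndexH ν) F, B * matH ν F * Bᵀ = matH ν F ∧
      y = x ᵥ* B.map (algebraMap F L) := by
  set MX := moore F (fun a => (indexEquiv ν a : ℕ)) x with hMX
  set MY := moore F (fun a => (indexEquiv ν a : ℕ)) y with hMY
  have hdet : IsUnit MX.det := isUnit_det_moore (indexEquiv ν) hx
  have hunit : IsUnit MX := (Matrix.isUnit_iff_isUnit_det _).2 hdet
  obtain ⟨B, hMB⟩ : ∃ B, MX * B = MY :=
    ⟨MX⁻¹ * MY, by rw [← Matrix.mul_assoc, Matrix.mul_nonsing_inv _ hdet, Matrix.one_mul]⟩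
  have hgram : MX * matH ν L * MXᵀ = MY * matH ν L * MYᵀ := by
    ext a b
    rw [gram_apply, gram_apply]
    exact hyp_pow_pow_congr F h (indexEquiv ν a).isLt.le (indexEquiv ν b).isLt.le
  have hBH : B * matH ν L * Bᵀ = matH ν L := by
    have hunit' : IsUnit MXᵀ := (Matrix.isUnit_transpose _).2 hunit
    refine hunit.mul_left_cancel (hunit'.mul_right_cancel ?_)
    rw [hgram, ← hMB, Matrix.transpose_mul]
    simp only [Matrix.mul_assoc]
  have hBunit : IsUnit B := isUnit_of_mul_mul_transpose isUnit_matH hBH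
  -- `B` is an isometry, so it also carries the Frobenius power of `x` that follows the rows
  -- of `MX` to that of `y`: both have the same pairings with the rows.
  have hlast : (fun i => x i ^ Fintype.card F ^ (2 * ν)) ᵥ* B =
      fun i => y i ^ Fintype.card F ^ (2 * ν) := by
    set u := fun i => x i ^ Fintype.card F ^ (2 * ν)
    set v := fun i => y i ^ Fintype.card F ^ (2 * ν)
    have h1 : MX *ᵥ (matH ν L *ᵥ u) = MY *ᵥ (matH ν L *ᵥ v) := by
      ext a
      exact hyp_pow_pow_congr F h (indexEquiv ν a).isLt.le le_rfl
    have h2 : MX *ᵥ ((B * matH ν L) *ᵥ (u ᵥ* B)) = MX *ᵥ ((B * matH ν L) *ᵥ v) := by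
      rw [← Matrix.mulVec_transpose B u, Matrix.mulVec_mulVec _ (B * matH ν L), hBH, h1, ← hMB]
      simp only [Matrix.mulVec_mulVec, Matrix.mul_assoc]
    exact Matrix.mulVec_injective_of_isUnit (hBunit.mul isUnit_matH)
      (Matrix.mulVec_injective_of_isUnit hunit h2)
  have hrow : ∀ j ≤ 2 * ν, (fun i => x i ^ Fintype.card F ^ j) ᵥ* B =
      fun i => y i ^ Fintype.card F ^ j := by
    intro j hj
    rcases hj.lt_or_eq with hj | rfl
    · have := congrFun hMB ((indexEquiv ν).symm ⟨j, hj⟩)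
      simpa [Matrix.mul_apply_eq_vecMul, hMX, hMY, moore_row] using this
    · exact hlast
  -- Applying Frobenius to `MX * B = MY` gives a second equation with the same solution `B`.
  set φ := (frobPow F L 1).toRingHom
  have hφ_apply : ∀ z, φ z = z ^ Fintype.card F := fun z => by
    simpa using! frobPow_apply F 1 z
  have hφB : B.map φ = B := by
    have hφunit : IsUnit (MX.map φ) := hunit.map φ.mapMatrix
    refine hφunit.mul_left_cancel ?_
    have h1 : MX.map φ * B.map φ = MY.map φ := by rw [← Matrix.map_mul, hMB]
    rw [h1]
    ext a i
    have h2 := congrFun (hrow (indexEquiv ν a + 1) (indexEquiv ν a).isLt) i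
    simp only [Matrix.map_apply, hφ_apply, Matrix.mul_apply, hMX, hMY, moore, Matrix.of_apply,
      ← pow_mul, ← pow_succ]
    exact h2.symm
  have hB0 : ∀ i j, ∃ b : F, algebraMap F L b = B i j := fun i j =>
    mem_range_algebraMap_of_pow_card_eq F (by
      rw [← hφ_apply]; exact congrFun (congrFun hφB i) j)
  choose B0 hB0 using hB0
  have hmap : (Matrix.of B0).map (algebraMap F L) = B := by
    ext i j
    exact hB0 i j
  refine ⟨Matrix.of B0, ?_, ?_⟩
  · apply Matrix.map_injective (algebraMap F L).injective
    dsimp only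
    rw [Matrix.map_mul, Matrix.map_mul, Matrix.transpose_map, hmap, matH_map, hBH]
  · rw [hmap]
    simpa using (hrow 0 (Nat.zero_le _)).symm

/-- If the values `x H ᵗ(x ^ q ^ k)` with `1 ≤ k ≤ 2ν` lie in a subfield, then the entries of `x`
are roots of a monic `q`-polynomial of degree `q ^ (2ν)` over that subfield: its coefficients are
found by pairing with the Frobenius powers of `x`. -/
theorem exists_qPolynomial [CharP L 2] {x : IndexH ν → L} (hx : LinearIndependent F x)
    {K : Type*} [Field K] [Algebra K L]
    (h : ∀ k ∈ Set.Icc 1 (2 * ν),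
      hyp x (fun i => x i ^ Fintype.card F ^ k) ∈ (algebraMap K L).range) :
    ∃ c : IndexH ν → K, ∀ i, x i ^ Fintype.card F ^ (2 * ν) =
      ∑ a, algebraMap K L (c a) * x i ^ Fintype.card F ^ (indexEquiv ν a : ℕ) := by
  set M := moore F (fun a => (indexEquiv ν a : ℕ)) x with hM
  have hunit : IsUnit M := (Matrix.isUnit_iff_isUnit_det _).2 (isUnit_det_moore (indexEquiv ν) hx)
  have hunit' : IsUnit Mᵀ := (Matrix.isUnit_transpose _).2 hunit
  set u := fun i => x i ^ Fintype.card F ^ (2 * ν)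
  have hG : ∀ a b, ∃ g : K, algebraMap K L g = (M * matH ν L * Mᵀ) a b := by
    intro a b
    rw [gram_apply]
    exact hyp_pow_pow_mem F h (indexEquiv ν a).isLt.le (indexEquiv ν b).isLt.le
  have hg : ∀ b, ∃ g : K, algebraMap K L g = (u ᵥ* (matH ν L * Mᵀ)) b := by
    intro b
    have h1 : (u ᵥ* (matH ν L * Mᵀ)) b = hyp u (M b) := by
      rw [← Matrix.vecMul_vecMul, hyp, Matrix.dotProduct_mulVec]
      rfl
    rw [h1]
    exact hyp_pow_pow_mem F h le_rfl (indexEquiv ν b).isLt.le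
  choose G hG using hG
  choose g hg using hg
  have hGmap : (Matrix.of G).map (algebraMap K L) = M * matH ν L * Mᵀ := by
    ext a b
    exact hG a b
  have hGdet : IsUnit (Matrix.of G).det := by
    have h1 : IsUnit (M * matH ν L * Mᵀ) := (hunit.mul isUnit_matH).mul hunit'
    rw [Matrix.isUnit_iff_isUnit_det, ← hGmap, isUnit_iff_ne_zero] at h1
    rw [isUnit_iff_ne_zero]
    intro h0
    apply h1
    rw [← RingHom.mapMatrix_apply, ← RingHom.map_det, h0, map_zero]
  -- Solving against the Gram matrix already over `K` gives coefficients in `K`.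
  refine ⟨g ᵥ* (Matrix.of G)⁻¹, ?_⟩
  set c := g ᵥ* (Matrix.of G)⁻¹ with hc
  have hcG : c ᵥ* Matrix.of G = g := by
    rw [hc, Matrix.vecMul_vecMul, Matrix.nonsing_inv_mul _ hGdet, Matrix.vecMul_one]
  have hcL : (fun a => algebraMap K L (c a)) ᵥ* (M * matH ν L * Mᵀ) =
      u ᵥ* (matH ν L * Mᵀ) := by
    ext b
    rw [← hg, ← hGmap, ← hcG, RingHom.map_vecMul]
    rfl
  rw [Matrix.mul_assoc, ← Matrix.vecMul_vecMul] at hcL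
  have := Matrix.vecMul_injective_of_isUnit (isUnit_matH.mul hunit') hcL
  exact fun i => (congrFun this i).symm

/-- If `L` is generated over `K` by linearly independent elements `x i` and the values
`x H ᵗ(x ^ q ^ k)` with `1 ≤ k ≤ 2ν` lie in `K`, then `L` is the splitting field of a separable
polynomial over `K`. -/
theorem isGalois_of_hyp_mem [CharP L 2] {x : IndexH ν → L} (hx : LinearIndependent F x)
    {K : Type*} [Field K] [Algebra K L]
    (h : ∀ k ∈ Set.Icc 1 (2 * ν),
      hyp x (fun i => x i ^ Fintype.card F ^ k) ∈ (algebraMap K L).range)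
    (htop : IntermediateField.adjoin K (Set.range x) = ⊤) : IsGalois K L := by
  obtain ⟨c, hc⟩ := exists_qPolynomial hx h
  obtain ⟨p, hsep, hsplits, hroot⟩ := separable_and_splits_of_qPolynomial (indexEquiv ν) hx c hc
  have hsf : p.IsSplittingField K L := by
    refine isSplittingField_iff_intermediateField.2 ⟨hsplits, top_le_iff.1 ?_⟩
    rw [← htop]
    exact IntermediateField.adjoin.mono K _ _ (Set.range_subset_iff.2 hroot)
  exact IsGalois.of_separable_splitting_field hsep

/-- An automorphism fixing the values `x H ᵗ(x ^ q ^ k)` with `1 ≤ k ≤ 2ν` acts on the vector `x`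
by a symplectic matrix with entries in `F`. -/
theorem exists_symplectic_of_algEquiv [CharP L 2] {x : IndexH ν → L}
    (hx : LinearIndependent F x) {K : Type*} [Field K] [Algebra K L]
    (h : ∀ k ∈ Set.Icc 1 (2 * ν),
      hyp x (fun i => x i ^ Fintype.card F ^ k) ∈ (algebraMap K L).range) (τ : L ≃ₐ[K] L) :
    ∃ B : Matrix (IndexH ν) (IndexH ν) F, B * matH ν F * Bᵀ = matH ν F ∧
      (fun i => τ (x i)) = x ᵥ* B.map (algebraMap F L) := by
  refine exists_symplectic_of_hyp_eq hx fun k hk => ?_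
  obtain ⟨g, hg⟩ := h k hk
  have h1 := map_hyp τ x fun i => x i ^ Fintype.card F ^ k
  simp only [map_pow] at h1
  rw [← h1, ← hg, τ.commutes]

/-- An element of `L` fixed by every automorphism that acts on the generators `x i` by a symplectic
matrix with entries in `F` lies in any intermediate field `K` containing the values
`x H ᵗ(x ^ q ^ k)` with `1 ≤ k ≤ 2ν` over which the `x i` generate `L`. -/
theorem mem_of_forall_algEquiv [CharP F 2] {x : IndexH ν → L} (hx : LinearIndependent F x)
    (K : IntermediateField F L)
    (h : ∀ k ∈ Set.Icc 1 (2 * ν), hyp x (fun i => x i ^ Fintype.card F ^ k) ∈ K)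
    (htop : IntermediateField.adjoin K (Set.range x) = ⊤) {f : L}
    (hf : ∀ τ : L ≃ₐ[K] L, ∀ B : Matrix (IndexH ν) (IndexH ν) F, B * matH ν F * Bᵀ = matH ν F →
      (∀ i, τ (x i) = (x ᵥ* B.map (algebraMap F L)) i) → τ f = f) : f ∈ K := by
  have : CharP L 2 := charP_of_injective_algebraMap (algebraMap F L).injective 2
  have hmem : ∀ k ∈ Set.Icc 1 (2 * ν),
      hyp x (fun i => x i ^ Fintype.card F ^ k) ∈ (algebraMap K L).range :=
    fun k hk => ⟨⟨_, h k hk⟩, rfl⟩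
  have : IsGalois K L := isGalois_of_hyp_mem hx hmem htop
  have hbot : f ∈ (⊥ : IntermediateField K L) := by
    refine (InfiniteGalois.mem_bot_iff_fixed f).2 fun τ => ?_
    obtain ⟨B, hB, hy⟩ := exists_symplectic_of_algEquiv hx hmem τ
    exact hf τ B hB (congrFun hy)
  obtain ⟨g, rfl⟩ := IntermediateField.mem_bot.1 hbot
  exact g.2

end Hyperbolic

/-! ### The pseudo-symplectic group in characteristic two -/

section Group

variable {ν : ℕ} {F : Type*} [Field F]

theorem isUnit_matS : IsUnit (matS ν F) := by
  have h : matS ν F * matS ν F = 1 := by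
    simp [matS, Matrix.fromBlocks_multiply, matH_mul_self]
  exact ⟨⟨_, _, h, h⟩, rfl⟩

/-- A symplectic matrix `A` gives the pseudo-symplectic matrix `diag(A, 1)`. -/
theorem exists_mem_Ps {A : Matrix (IndexH ν) (IndexH ν) F} (hA : A * matH ν F * Aᵀ = matH ν F) :
    ∃ T ∈ Ps ν F, (T : Matrix (IndexS ν) (IndexS ν) F) = Matrix.fromBlocks A 0 0 1 := by
  have h : Matrix.fromBlocks A 0 0 1 * matS ν F * (Matrix.fromBlocks A 0 0 1)ᵀ = matS ν F := by
    simp [matS, Matrix.fromBlocks_multiply, Matrix.fromBlocks_transpose, hA]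
  obtain ⟨T, hT⟩ := isUnit_of_mul_mul_transpose isUnit_matS h
  refine ⟨T, ?_, hT⟩
  change (T : Matrix (IndexS ν) (IndexS ν) F) * matS ν F *
    (T : Matrix (IndexS ν) (IndexS ν) F)ᵀ = matS ν F
  rw [hT, h]

/-- In characteristic two every pseudo-symplectic matrix has the form `diag(A, 1)` with `A`
symplectic. -/
theorem exists_fromBlocks_of_mem_Ps [CharP F 2] {T : GL (IndexS ν) F} (hT : T ∈ Ps ν F) :
    ∃ A : Matrix (IndexH ν) (IndexH ν) F, A * matH ν F * Aᵀ = matH ν F ∧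
      (T : Matrix (IndexS ν) (IndexS ν) F) = Matrix.fromBlocks A 0 0 1 := by
  change (T : Matrix (IndexS ν) (IndexS ν) F) * matS ν F *
    (T : Matrix (IndexS ν) (IndexS ν) F)ᵀ = matS ν F at hT
  generalize (T : Matrix (IndexS ν) (IndexS ν) F) = U at hT ⊢
  obtain ⟨A, b, c, d, rfl⟩ : ∃ A b c d, U = Matrix.fromBlocks A b c d :=
    ⟨_, _, _, _, (Matrix.fromBlocks_toBlocks U).symm⟩
  simp only [matS, Matrix.fromBlocks_multiply, Matrix.fromBlocks_transpose, Matrix.mul_zero,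
    Matrix.mul_one, add_zero, zero_add, Matrix.fromBlocks_inj] at hT
  obtain ⟨h11, h12, -, h22⟩ := hT
  -- The diagonal of `T S ᵗT = S` consists of the squares of the last column of `T`.
  have hb : b = 0 := by
    ext i j
    have h := congrFun (congrFun h11 i) i
    rw [Matrix.add_apply, gram_apply, hyp_self, zero_add] at h
    have h0 : matH ν F i i = 0 := by rcases i with i | i <;> simp [matH]
    rw [h0, Matrix.mul_apply, Fin.sum_univ_one, Matrix.transpose_apply] at h
    rw [Subsingleton.elim j 0, Matrix.zero_apply]
    exact mul_self_eq_zero.1 h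
  have hd : d = 1 := by
    ext i j
    have h := congrFun (congrFun h22 0) 0
    rw [Matrix.add_apply, gram_apply, hyp_self, zero_add, Matrix.mul_apply, Fin.sum_univ_one,
      Matrix.transpose_apply, Matrix.one_apply_eq, mul_self_eq_one_iff, CharTwo.neg_eq, or_self]
      at h
    rw [Subsingleton.elim i 0, Subsingleton.elim j 0, h, Matrix.one_apply_eq]
  subst hb hd
  rw [Matrix.zero_mul, add_zero] at h11 h12
  have hAH : IsUnit (A * matH ν F) := (isUnit_of_mul_mul_transpose isUnit_matH h11).mul isUnit_matH
  have hc : cᵀ = 0 := by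
    rw [← Matrix.one_mul cᵀ, ← Matrix.nonsing_inv_mul _
      ((Matrix.isUnit_iff_isUnit_det _).1 hAH), Matrix.mul_assoc, h12, Matrix.mul_zero]
  rw [Matrix.transpose_eq_zero] at hc
  exact ⟨A, h11, by rw [hc]⟩

end Group

/-! ### The rational function field -/

section RationalFunctions

variable {ι : Type*} {F : Type*} [Field F]

theorem linearIndependent_ratX : LinearIndependent F (ratX F : ι → RatField ι F) := by
  have h := (MvPolynomial.linearIndependent_X ι F).map'
    (IsScalarTower.toAlgHom F (MvPolynomial ι F) (RatField ι F)).toLinearMap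
    (LinearMap.ker_eq_bot.2 (IsFractionRing.injective (MvPolynomial ι F) (RatField ι F)))
  exact h

theorem eq_top_of_ratX_mem (E : IntermediateField F (RatField ι F)) (h : ∀ i, ratX F i ∈ E) :
    E = ⊤ := by
  have hpoly : ∀ p : MvPolynomial ι F, algebraMap _ (RatField ι F) p ∈ E := by
    intro p
    induction p using MvPolynomial.induction_on with
    | C a =>
      have := E.algebraMap_mem a
      rwa [IsScalarTower.algebraMap_apply F (MvPolynomial ι F) (RatField ι F)] at this
    | add p q hp hq => rw [map_add]; exact add_mem hp hq
    | mul_X p i hp => rw [map_mul]; exact mul_mem hp (h i)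
  refine eq_top_iff.2 fun f _ => ?_
  obtain ⟨p, q, -, rfl⟩ := IsFractionRing.div_surjective (A := MvPolynomial ι F) f
  exact div_mem (hpoly p) (hpoly q)

theorem ratField_algHom_ext {L : Type*} [Field L] [Algebra F L] {f g : RatField ι F →ₐ[F] L}
    (h : ∀ i, f (ratX F i) = g (ratX F i)) : f = g := by
  apply AlgHom.coe_ringHom_injective
  refine IsLocalization.ringHom_ext (nonZeroDivisors (MvPolynomial ι F)) ?_
  refine MvPolynomial.ringHom_ext (fun a => ?_) h
  change f (algebraMap F (RatField ι F) a) = g (algebraMap F (RatField ι F) a)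
  rw [f.commutes, g.commutes]

end RationalFunctions

/-! ### The invariants -/

section Invariants

variable {ν : ℕ} {F : Type*} [Field F]

variable (ν F) in
/-- The vector `(X_1, …, X_{2ν})` of the indeterminates of the first block. -/
def blockX (i : IndexH ν) : RatField (IndexS ν) F :=
  ratX F (Sum.inl i)

theorem linearIndependent_blockX : LinearIndependent F (blockX ν F) :=
  linearIndependent_ratX.comp Sum.inl Sum.inl_injective

theorem polyP_eq_hyp [Fintype F] (k : ℕ) :
    polyP ν F k = hyp (blockX ν F) (fun i => blockX ν F i ^ Fintype.card F ^ k) := by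
  rw [polyP, matH_map]
  rfl

theorem sigma_blockX {T : GL (IndexS ν) F} {A : Matrix (IndexH ν) (IndexH ν) F}
    (hT : (T : Matrix (IndexS ν) (IndexS ν) F) = Matrix.fromBlocks A 0 0 1) (i : IndexH ν) :
    sigma T (blockX ν F i) = (blockX ν F ᵥ* A.map (algebraMap F _)) i := by
  rw [blockX, sigma_ratX, Fintype.sum_sum_type, hT]
  simp [Matrix.vecMul, dotProduct, blockX]

theorem sigma_lastX {T : GL (IndexS ν) F} {A : Matrix (IndexH ν) (IndexH ν) F}
    (hT : (T : Matrix (IndexS ν) (IndexS ν) F) = Matrix.fromBlocks A 0 0 1) :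
    sigma T (ratX F (lastIndex ν)) = ratX F (lastIndex ν) := by
  rw [sigma_ratX, Fintype.sum_sum_type, hT]
  simp

theorem sigma_polyP [Fintype F] {T : GL (IndexS ν) F} {A : Matrix (IndexH ν) (IndexH ν) F}
    (hA : A * matH ν F * Aᵀ = matH ν F)
    (hT : (T : Matrix (IndexS ν) (IndexS ν) F) = Matrix.fromBlocks A 0 0 1) (k : ℕ) :
    sigma T (polyP ν F k) = polyP ν F k := by
  set f := algebraMap F (RatField (IndexS ν) F)
  have hAL : A.map f * matH ν (RatField (IndexS ν) F) * (A.map f)ᵀ =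
      matH ν (RatField (IndexS ν) F) := by
    rw [← matH_map f, ← Matrix.transpose_map, ← Matrix.map_mul, ← Matrix.map_mul, hA]
  have hpow : (fun i => (blockX ν F ᵥ* A.map f) i ^ Fintype.card F ^ k) =
      (fun i => blockX ν F i ^ Fintype.card F ^ k) ᵥ* A.map f := by
    ext i
    simp only [Matrix.vecMul, dotProduct, ← frobPow_apply, map_sum, map_mul, Matrix.map_apply,
      AlgHom.commutes, f]
  rw [polyP_eq_hyp]
  have h := map_hyp (sigma T) (blockX ν F) fun i => blockX ν F i ^ Fintype.card F ^ k
  simp only [map_pow, sigma_blockX hT] at h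
  rw [h, hpow, hyp_vecMul hAL]

theorem invariantField_le_adjoin (F : Type*) [Field F] [Fintype F] [CharP F 2] (ν : ℕ) :
    invariantField (Ps ν F) ≤
      IntermediateField.adjoin F (polyP ν F '' Set.Icc 1 (2 * ν) ∪ {ratX F (lastIndex ν)}) := by
  set K := IntermediateField.adjoin F
    (polyP ν F '' Set.Icc 1 (2 * ν) ∪ {ratX F (lastIndex ν)})
  have hP : ∀ k ∈ Set.Icc 1 (2 * ν), polyP ν F k ∈ K := fun k hk =>
    IntermediateField.subset_adjoin F _ (Or.inl ⟨k, hk, rfl⟩)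
  have hX : ratX F (lastIndex ν) ∈ K := IntermediateField.subset_adjoin F _ (Or.inr rfl)
  have htop : IntermediateField.adjoin K (Set.range (blockX ν F)) = ⊤ := by
    rw [← IntermediateField.restrictScalars_eq_top_iff (K := F)]
    refine eq_top_of_ratX_mem _ ?_
    rintro (i | i)
    · exact IntermediateField.subset_adjoin K _ ⟨i, rfl⟩
    · rw [Subsingleton.elim i 0]
      exact IntermediateField.algebraMap_mem _ (⟨_, hX⟩ : K)
  intro f hf
  apply mem_of_forall_algEquiv (L := RatField (IndexS ν) F) linearIndependent_blockX K
    (fun k hk => by rw [← polyP_eq_hyp]; exact hP k hk) htop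
  intro τ B hB hy
  obtain ⟨T, hT, hTB⟩ := exists_mem_Ps hB
  have hτ : (τ.toAlgHom.restrictScalars F) = (sigma T).toAlgHom := by
    refine ratField_algHom_ext ?_
    rintro (i | i)
    · exact (hy i).trans (sigma_blockX hTB i).symm
    · rw [Subsingleton.elim i 0]
      exact (τ.commutes ⟨_, hX⟩).trans (sigma_lastX hTB).symm
  exact (DFunLike.congr_fun hτ f).trans (hf T hT)

end Invariants

end PseudoSymplectic

end

theorem theorem4p1 (F : Type*) [Field F] [Fintype F] [CharP F 2] (ν : ℕ) :
    PseudoSymplectic.invariantField (PseudoSymplectic.Ps ν F) =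
      IntermediateField.adjoin F
        (PseudoSymplectic.polyP ν F '' Set.Icc 1 (2 * ν) ∪
          {PseudoSymplectic.ratX F (PseudoSymplectic.lastIndex ν)}) := by
  refine le_antisymm (PseudoSymplectic.invariantField_le_adjoin F ν)
    (IntermediateField.adjoin_le_iff.2 ?_)
  rintro _ (⟨k, -, rfl⟩ | rfl) T hT
  · obtain ⟨A, hA, hTA⟩ := PseudoSymplectic.exists_fromBlocks_of_mem_Ps hT
    exact PseudoSymplectic.sigma_polyP hA hTA k
  · obtain ⟨A, -, hTA⟩ := PseudoSymplectic.exists_fromBlocks_of_mem_Ps hT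
    exact PseudoSymplectic.sigma_lastX hTA
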